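/- Let $(\Omega,\mathcal F,\mathbb P)$ be a probability space and let $(M_N)_{N\ge1}$ be random matrices on it such that, for every $N\ge1$, $M_N$ takes values in the Hermitian $N\times N$ complex matrices and belongs to the Gaussian Unitary Ensemble: the $N^2$ real random variables $(M_N)_{i,i}$ $(1\le i\le N)$, $\sqrt2\,\mathrm{Re}\,(M_N)_{i,j}$ and $\sqrt2\,\mathrm{Im}\,(M_N)_{i,j}$ $(1\le i<j\le N)$ are independent with law $\mathcal N(0,1)$. (No assumption is made on the joint law of the matrices for different $N$.) Let $\lambda_1^N,\dots,\lambda_N^N\in\mathbb R$ be the eigenvalues of $M_N$, counted with multiplicity, and let $$\mu_N=\frac1N\sum_{k=1}^N\delta_{\lambda_k^N/\sqrt N}$$ be the empirical spectral distribution of $M_N/\sqrt N$. Let $\sigma$ be the semicircle distribution, the probability measure on $\mathbb R$ with density $x\mapsto\frac{\sqrt{4-x^2}}{2\pi}\mathbf 1_{[-2,2]}(x)$ with respect to the Lebesgue measure. Then, almost surely, $\mu_N$ converges weakly to $\sigma$ as $N\to\infty$; that is, almost surely, for every bounded continuous $f:\mathbb R\to\mathbb R$, $\int f\,d\mu_N\to\int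 f\,d\sigma$. -/

import Mathlib

open MeasureTheory ProbabilityTheory Filter Topology
open scoped ENNReal NNReal

noncomputable section

/-- The type of Hermitian `N × N` complex matrices. -/
abbrev HermitianMatrix (N : ℕ) : Type :=
  {A : Matrix (Fin N) (Fin N) ℂ // A.IsHermitian}

/-- Index set of the `N ^ 2` real coordinates of a Hermitian matrix: the diagonal positions, then
two copies (real and imaginary parts) of the positions `(i, j)` with `i < j`. -/
abbrev GUEIndex (N : ℕ) : Type :=
  Fin N ⊕ ({p : Fin N × Fin N // p.1 < p.2} ⊕ {p : Fin N × Fin N // p.1 < p.2})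

/-- The coordinates `X i i`, `√2 * Re (X i j)` and `√2 * Im (X i j)`, `i < j`.
Diagonal entries of a Hermitian matrix are real, so they are read off through their real part. -/
def gueCoord {N : ℕ} (X : HermitianMatrix N) : GUEIndex N → ℝ
  | .inl i => (X.1 i i).re
  | .inr (.inl p) => √2 * (X.1 p.1.1 p.1.2).re
  | .inr (.inr p) => √2 * (X.1 p.1.1 p.1.2).im

/-- `X` is a random matrix of the Gaussian Unitary Ensemble of size `N` (an `N` complex Wigner
matrix): it is Hermitian, and the variables `X i i`, `√2 * Re (X i j)`, `√2 * Im (X i j)`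
(`i < j`) are independent with law `𝒩(0, 1)`. -/
structure IsGUE {Ω : Type*} [MeasurableSpace Ω] {N : ℕ} (X : Ω → HermitianMatrix N)
    (P : Measure Ω) : Prop where
  hasLaw : ∀ a : GUEIndex N, HasLaw (fun ω => gueCoord (X ω) a) (gaussianReal 0 1) P
  indep : iIndepFun (fun (a : GUEIndex N) (ω : Ω) => gueCoord (X ω) a) P

/-- The measure `(1 / N) * ∑ k, δ_{λ k / √N}`, where `λ 1, …, λ N` are the eigenvalues of `A`
with multiplicity. -/
def scaledSpectralMeasure {N : ℕ} (A : HermitianMatrix N) : Measure ℝ :=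
  (N : ℝ≥0∞)⁻¹ • ∑ k : Fin N, Measure.dirac (A.2.eigenvalues k / √(N : ℝ))

instance {N : ℕ} [NeZero N] (A : HermitianMatrix N) :
    IsProbabilityMeasure (scaledSpectralMeasure A) where
  measure_univ := by
    simp [scaledSpectralMeasure, ENNReal.inv_mul_cancel, NeZero.ne N]

/-- The empirical spectral distribution `μ_N` of `A / √N`, as a probability measure on `ℝ`. -/
def empiricalSpectralDistribution {N : ℕ} [NeZero N] (A : HermitianMatrix N) :
    ProbabilityMeasure ℝ :=
  ⟨scaledSpectralMeasure A, inferInstance⟩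

/-- The density `√(4 - x ^ 2) / (2 π)` on `[-2, 2]`, zero elsewhere. -/
def semicircleDensity (x : ℝ) : ℝ :=
  Set.indicator (Set.Icc (-2) 2) (fun y => √(4 - y ^ 2) / (2 * Real.pi)) x

/-- The semicircle measure: Lebesgue measure weighted by the semicircle density. -/
def semicircleMeasure : Measure ℝ :=
  volume.withDensity fun x => ENNReal.ofReal (semicircleDensity x)

theorem integral_semicircle : ∫ x in (-2 : ℝ)..2, √(4 - x ^ 2) / (2 * Real.pi) = 1 := by
  have h := intervalIntegral.integral_comp_mul_left (a := -1) (b := 1)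
    (fun x : ℝ => √(4 - x ^ 2)) (c := 2) (by norm_num)
  have h2 : ∀ x : ℝ, √(4 - (2 * x) ^ 2) = 2 * √(1 - x ^ 2) := by
    intro x
    rw [show 4 - (2 * x) ^ 2 = 2 ^ 2 * (1 - x ^ 2) by ring,
      Real.sqrt_mul (by norm_num), Real.sqrt_sq (by norm_num)]
  simp only [h2, intervalIntegral.integral_const_mul, integral_sqrt_one_sub_sq, smul_eq_mul] at h
  norm_num at h
  rw [intervalIntegral.integral_div]
  have hp := Real.pi_ne_zero
  field_simp
  linarith

instance : IsProbabilityMeasure semicircleMeasure where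
  measure_univ := by
    have hind : ∀ x, ENNReal.ofReal (semicircleDensity x) = (Set.Icc (-2 : ℝ) 2).indicator
        (fun y => ENNReal.ofReal (√(4 - y ^ 2) / (2 * Real.pi))) x := by
      intro x
      by_cases hx : x ∈ Set.Icc (-2 : ℝ) 2 <;> simp [semicircleDensity, hx]
    have hc : Continuous fun y : ℝ => √(4 - y ^ 2) / (2 * Real.pi) := by fun_prop
    rw [semicircleMeasure, withDensity_apply _ MeasurableSet.univ, Measure.restrict_univ]
    simp_rw [hind]
    rw [lintegral_indicator measurableSet_Icc, ← ofReal_integral_eq_lintegral_ofReal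
      (hc.continuousOn.integrableOn_Icc) (Eventually.of_forall fun y => by positivity),
      integral_Icc_eq_integral_Ioc, ← intervalIntegral.integral_of_le (by norm_num),
      integral_semicircle, ENNReal.ofReal_one]

/-- The Wigner semicircle distribution `σ`, as a probability measure on `ℝ`. -/
def semicircleDistribution : ProbabilityMeasure ℝ :=
  ⟨semicircleMeasure, inferInstance⟩

end

/-!
The proof is by the method of moments, with the loop (Schwinger–Dyson) equations of the Gaussian
Unitary Ensemble in place of the combinatorics of pairings.

For `X = M_N / √N` put `t_k = N⁻¹ tr (X ^ k)`, the `k`-th moment of `μ_N`. Gaussian integration by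
parts (`gaussianExpectation_X_mul`), applied to one factor `X` of a trace, gives
`E [t_{k+1} Q] = ∑_{a < k} E [t_a t_{k-1-a} Q] + N⁻² E [Q']` for every product `Q` of such traces,
where `Q'` is a sum of products of traces whose number does not depend on `N`
(`loopEquations_traceProd`). The total degree drops at each step, so by induction the expectation of
a product of `t_k` is the product of the corresponding `m_k` up to `O(N⁻²)`, where `m` solves
`m_{k+1} = ∑_{a < k} m_a m_{k-1-a}`, `m_0 = 1` (`LoopEquations.exists_norm_sub_le`). Applied to
`t_k` and to `t_k ^ 2` this yields both the limit and the concentration of the moments at once: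
`E [(t_k - m_k) ^ 2] = O(N⁻²)` (`exists_integral_sq_spectralMoment_sub_le`). These bounds are
summable over `N`, so almost surely `t_k → m_k` for all `k`, whatever the joint law of the matrices.

The recursion is that of the Catalan numbers, and the `m_k` are the moments of the semicircle
distribution (`integral_pow_semicircleMeasure`). As this limit has compact support, convergence of
moments implies weak convergence (`tendsto_probabilityMeasure_of_tendsto_moments`).

Products of traces are encoded as lists of exponents, and all expectations are computed in the ring
of polynomials in the `N ^ 2` real coordinates of the matrix.
-/

/-! ### Loop equations -/

/-- The lists obtained from `l` by choosing one of its entries `m`, replacing it by `k + m - 1`,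
and keeping the rest; each such list is repeated `m` times, so that `m = 0` contributes none and the
subtraction is a true one. They index the terms produced when the
derivation attached to the `k`-th power of a matrix acts on a product of traces of powers. -/
def cutJoin (k : ℕ) : List ℕ → List (List ℕ)
  | [] => []
  | m :: l => List.replicate m ((k + m - 1) :: l) ++ (cutJoin k l).map (List.cons m)

lemma sum_add_one_of_mem_cutJoin {k : ℕ} {l l' : List ℕ} (h : l' ∈ cutJoin k l) :
    l'.sum + 1 = k + l.sum := by
  induction l generalizing l' with
  | nil => simp [cutJoin] at h
  | cons m l ih =>
    simp only [cutJoin, List.mem_append, List.mem_replicate, List.mem_map] at h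
    rcases h with ⟨hm, rfl⟩ | ⟨l'', hl, rfl⟩
    · simp only [List.sum_cons]; omega
    · have := ih hl
      simp only [List.sum_cons]; omega

/-- The loop (Schwinger–Dyson) equations of a Hermitian Gaussian matrix model. Here `φ l` plays the
role of the expectation of the product, over the entries `k` of `l`, of the normalized traces of the
`k`-th powers, and `c` is the inverse of the size of the matrix. The subtraction in `k - 1 - a` does
not truncate for `a < k`. -/
structure LoopEquations (φ : List ℕ → ℂ) (c : ℝ) : Prop where
  nil : φ [] = 1
  zero_cons : ∀ l, φ (0 :: l) = φ l
  succ_cons : ∀ k l, φ ((k + 1) :: l) =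
    ∑ a ∈ Finset.range k, φ (a :: (k - 1 - a) :: l) + (c : ℂ) ^ 2 * ((cutJoin k l).map φ).sum
  nonneg : 0 ≤ c
  le_one : c ≤ 1

lemma LoopEquations.exists_norm_sum_map_le (L : List (List ℕ))
    (h : ∀ l ∈ L, ∃ B : ℝ, ∀ φ c, LoopEquations φ c → ‖φ l‖ ≤ B) :
    ∃ B : ℝ, ∀ φ c, LoopEquations φ c → ‖(L.map φ).sum‖ ≤ B := by
  induction L with
  | nil => exact ⟨0, by simp⟩
  | cons l L ih =>
    obtain ⟨B, hB⟩ := ih fun l' hl' => h l' (List.mem_cons_of_mem _ hl')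
    obtain ⟨A, hA⟩ := h l List.mem_cons_self
    refine ⟨A + B, fun φ c hφ => ?_⟩
    simp only [List.map_cons, List.sum_cons]
    exact (norm_add_le _ _).trans (add_le_add (hA φ c hφ) (hB φ c hφ))

/-- The solutions of the loop equations factorize up to an error of order `c ^ 2`, with a constant
that depends on the list alone. Each equation expresses `φ l` through lists of smaller sum, so this
is an induction on the sum of `l` (and, for leading zeros, on its length). -/
theorem LoopEquations.exists_norm_sub_le {m : ℕ → ℂ} (m_zero : m 0 = 1)
    (m_succ : ∀ k, m (k + 1) = ∑ a ∈ Finset.range k, m a * m (k - 1 - a)) (l : List ℕ) :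
    ∃ C : ℝ, ∀ φ c, LoopEquations φ c → ‖φ l - (l.map m).prod‖ ≤ C * c ^ 2 := by
  induction hn : l.sum using Nat.strong_induction_on generalizing l with
  | _ n ih =>
    subst hn
    induction l with
    | nil => exact ⟨0, fun φ c h => by simp [h.nil]⟩
    | cons k l ihl =>
      cases k with
      | zero =>
        obtain ⟨C, hC⟩ := ihl (by simpa using ih)
        exact ⟨C, fun φ c h => by simpa [h.zero_cons, m_zero] using hC φ c h⟩
      | succ k =>
        have h1 : ∀ a ∈ Finset.range k, ∃ C : ℝ, ∀ φ c, LoopEquations φ c →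
            ‖φ (a :: (k - 1 - a) :: l) - m a * m (k - 1 - a) * (l.map m).prod‖ ≤ C * c ^ 2 := by
          intro a ha
          rw [Finset.mem_range] at ha
          simpa [mul_assoc] using ih _ (by simp only [List.sum_cons]; omega)
            (a :: (k - 1 - a) :: l) rfl
        have h2 : ∀ l' ∈ cutJoin k l, ∃ B : ℝ, ∀ φ c, LoopEquations φ c → ‖φ l'‖ ≤ B := by
          intro l' hl'
          have := sum_add_one_of_mem_cutJoin hl'
          obtain ⟨C, hC⟩ := ih _ (by simp only [List.sum_cons]; omega) l' rfl
          refine ⟨|C| + ‖(l'.map m).prod‖, fun φ c h => ?_⟩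
          have hc : c ^ 2 ≤ 1 := pow_le_one₀ h.nonneg h.le_one
          have : C * c ^ 2 ≤ |C| :=
            (mul_le_mul_of_nonneg_right (le_abs_self C) (sq_nonneg c)).trans
              (mul_le_of_le_one_right (abs_nonneg C) hc)
          linarith [hC φ c h, norm_le_norm_sub_add (φ l') (l'.map m).prod]
        choose! C hC using h1
        obtain ⟨B, hB⟩ := LoopEquations.exists_norm_sum_map_le _ h2
        refine ⟨∑ a ∈ Finset.range k, C a + B, fun φ c h => ?_⟩
        rw [h.succ_cons, List.map_cons, List.prod_cons, m_succ, Finset.sum_mul, add_sub_right_comm,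
          ← Finset.sum_sub_distrib, add_mul, Finset.sum_mul]
        refine (norm_add_le _ _).trans (add_le_add ?_ ?_)
        · exact norm_sum_le_of_le _ fun a ha => hC a ha φ c h
        · rw [norm_mul, norm_pow, Complex.norm_real, Real.norm_eq_abs, sq_abs, mul_comm]
          exact mul_le_mul_of_nonneg_right (hB φ c h) (sq_nonneg c)

section GenericModel

variable {R : Type*} [CommRing R] [Algebra ℂ R] {n : Type*} [Fintype n] [DecidableEq n]

/-- The product, over the entries `k` of `l`, of the normalized traces `c * tr (X ^ k)`. -/
def traceProd (c : ℝ) (X : Matrix n n R) (l : List ℕ) : R :=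
  (l.map fun k => (c : ℂ) • (X ^ k).trace).prod

variable {c : ℝ} {X : Matrix n n R} {D : n → n → Derivation ℂ R R}

/-- The matrix power rule, when `D i j` sends the entry `X j i` to `c` and every other entry
to `0`. -/
lemma derivation_pow_apply
    (hD : ∀ i j k l, D i j (X k l) = if i = l ∧ j = k then algebraMap ℂ R c else 0)
    (k : ℕ) (i j p q : n) :
    D i j ((X ^ k) p q) =
      (c : ℂ) • ∑ a ∈ Finset.range k, (X ^ a) p j * (X ^ (k - 1 - a)) i q := by
  induction k generalizing p q with
  | zero =>
    by_cases h : p = q <;> simp [Matrix.one_apply, h]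
  | succ k ih =>
    have h1 : ∑ r, (X ^ k) p r * D i j (X r q) = (c : ℂ) • ((X ^ k) p j * (X ^ 0) i q) := by
      rw [Finset.sum_eq_single j]
      · by_cases h : i = q <;> simp [hD, h, Algebra.smul_def, mul_comm]
      · intro r _ hr
        simp [hD, hr.symm]
      · simp
    have h2 : ∑ r, X r q * D i j ((X ^ k) p r) =
        (c : ℂ) • ∑ a ∈ Finset.range k, (X ^ a) p j * (X ^ (k - a)) i q := by
      simp_rw [ih, mul_smul_comm, ← Finset.smul_sum, Finset.mul_sum]
      rw [Finset.sum_comm]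
      congr 1
      refine Finset.sum_congr rfl fun a ha => ?_
      rw [Finset.mem_range] at ha
      rw [show k - a = k - 1 - a + 1 by omega, pow_succ, Matrix.mul_apply, Finset.mul_sum]
      exact Finset.sum_congr rfl fun r _ => by ring
    rw [pow_succ, Matrix.mul_apply, map_sum]
    simp_rw [Derivation.leibniz, smul_eq_mul, Finset.sum_add_distrib]
    rw [h1, h2, Finset.sum_range_succ, smul_add, add_comm]
    simp

/-- The derivation by which the factor `X ^ k`, left over after integrating by parts against one
entry of `tr (X ^ (k + 1))`, acts on the remaining traces: `∑ i j, (X ^ k) j i • D i j`. -/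
def powDerivation (X : Matrix n n R) (D : n → n → Derivation ℂ R R) (k : ℕ) :
    Derivation ℂ R R :=
  ∑ i, ∑ j, (X ^ k) j i • D i j

lemma powDerivation_apply (k : ℕ) (r : R) :
    powDerivation X D k r = ∑ i, ∑ j, (X ^ k) j i * D i j r := by
  simp only [powDerivation, ← Derivation.coeFnAddMonoidHom_apply, map_sum, Finset.sum_apply]
  simp

lemma powDerivation_trace
    (hD : ∀ i j k l, D i j (X k l) = if i = l ∧ j = k then algebraMap ℂ R c else 0)
    (k m : ℕ) :
    powDerivation X D k ((c : ℂ) • (X ^ m).trace) =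
      (c : ℂ) • m • ((c : ℂ) • (X ^ (k + m - 1)).trace) := by
  have h : ∀ i j, D i j (X ^ m).trace = (c : ℂ) • m • (X ^ (m - 1)) i j := by
    intro i j
    simp_rw [Matrix.trace, Matrix.diag, map_sum, derivation_pow_apply hD, ← Finset.smul_sum]
    rw [Finset.sum_comm]
    congr 1
    rw [← Finset.card_range m, ← Finset.sum_const, Finset.card_range]
    refine Finset.sum_congr rfl fun a ha => ?_
    rw [Finset.mem_range] at ha
    rw [show m - 1 = (m - 1 - a) + a by omega, pow_add, Matrix.mul_apply]
    exact Finset.sum_congr rfl fun r _ => by rw [mul_comm]; simp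
  rw [Derivation.map_smul, powDerivation_apply]
  congr 1
  simp_rw [h, mul_smul_comm, ← Finset.smul_sum]
  rw [smul_comm]
  rcases m.eq_zero_or_pos with rfl | hm
  · simp
  · congr 2
    rw [Nat.add_sub_assoc hm, pow_add, Matrix.trace, Finset.sum_comm]
    simp [Matrix.mul_apply]

lemma powDerivation_traceProd
    (hD : ∀ i j k l, D i j (X k l) = if i = l ∧ j = k then algebraMap ℂ R c else 0)
    (k : ℕ) (l : List ℕ) :
    powDerivation X D k (traceProd c X l) =
      (c : ℂ) • ((cutJoin k l).map (traceProd c X)).sum := by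
  induction l with
  | nil => simp [traceProd, cutJoin]
  | cons m l ih =>
    have h : ∀ m l, traceProd c X (m :: l) = (c : ℂ) • (X ^ m).trace * traceProd c X l := by
      intro m l; simp [traceProd]
    have h' : (traceProd c X ∘ List.cons m) = fun l => (c : ℂ) • (X ^ m).trace * traceProd c X l :=
      funext fun l => h m l
    rw [h, Derivation.leibniz, ih, powDerivation_trace hD, cutJoin, List.map_append,
      List.sum_append, List.map_replicate, List.sum_replicate, List.map_map, h',
      List.sum_map_mul_left, h]
    simp only [smul_eq_mul, Algebra.smul_def]
    ring

/-- A linear functional that satisfies Gaussian integration by parts satisfies the loop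
equations. -/
theorem loopEquations_traceProd
    (hD : ∀ i j k l, D i j (X k l) = if i = l ∧ j = k then algebraMap ℂ R c else 0)
    {E : R →ₗ[ℂ] ℂ} (hE : ∀ i j p, E (X i j * p) = E (D i j p)) (hE1 : E 1 = 1)
    (hc0 : 0 ≤ c) (hc1 : c ≤ 1) (hcard : c * Fintype.card n = 1) :
    LoopEquations (fun l => E (traceProd c X l)) c where
  nil := by simp [traceProd, hE1]
  zero_cons l := by
    have : (c : ℂ) • (X ^ 0).trace = (1 : R) := by
      have h : (c : ℂ) * Fintype.card n = 1 := by exact_mod_cast hcard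
      rw [pow_zero, Matrix.trace_one, Algebra.smul_def,
        ← map_natCast (algebraMap ℂ R), ← map_mul, h, map_one]
    rw [traceProd, List.map_cons, List.prod_cons, this, one_mul, traceProd]
  succ_cons k l := by
    have h1 : traceProd c X ((k + 1) :: l) =
        (c : ℂ) • ∑ i, ∑ j, X i j * ((X ^ k) j i * traceProd c X l) := by
      rw [traceProd, List.map_cons, List.prod_cons, ← traceProd, smul_mul_assoc, pow_succ',
        Matrix.trace, Finset.sum_mul]
      simp [Matrix.mul_apply, Finset.sum_mul, mul_assoc]
    have h2 : ∑ i, ∑ j, D i j ((X ^ k) j i * traceProd c X l) =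
        powDerivation X D k (traceProd c X l) +
          (c : ℂ) • ∑ a ∈ Finset.range k,
            (X ^ a).trace * (X ^ (k - 1 - a)).trace * traceProd c X l := by
      rw [powDerivation_apply]
      simp_rw [Derivation.leibniz, smul_eq_mul, Finset.sum_add_distrib, derivation_pow_apply hD,
        mul_smul_comm, ← Finset.smul_sum, Finset.mul_sum]
      congr 2
      rw [Finset.sum_congr rfl fun i _ => Finset.sum_comm, Finset.sum_comm]
      refine Finset.sum_congr rfl fun a _ => ?_
      simp_rw [Matrix.trace, Matrix.diag, Finset.sum_mul_sum, Finset.sum_mul]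
      rw [Finset.sum_comm]
      exact Finset.sum_congr rfl fun _ _ => Finset.sum_congr rfl fun _ _ => by ring
    have h3 : ∀ a b, traceProd c X (a :: b :: l) =
        (c : ℂ) • (c : ℂ) • ((X ^ a).trace * (X ^ b).trace * traceProd c X l) := by
      intro a b
      simp only [traceProd, List.map_cons, List.prod_cons, Algebra.smul_def]
      ring
    have h4 : ∀ L : List (List ℕ), E ((L.map (traceProd c X)).sum) =
        (L.map fun l => E (traceProd c X l)).sum := by
      intro L
      rw [map_list_sum, List.map_map]; rfl
    rw [h1, map_smul, map_sum]
    simp_rw [map_sum, hE]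
    simp_rw [← map_sum]
    rw [h2, powDerivation_traceProd hD, ← h4]
    simp_rw [h3, map_add, map_smul, map_sum, map_smul, smul_eq_mul, ← Finset.mul_sum]
    ring
  nonneg := hc0
  le_one := hc1

end GenericModel

/-! ### Gaussian integration by parts for polynomials -/

lemma integrable_pow_gaussianReal (n : ℕ) :
    Integrable (fun x : ℝ => x ^ n) (gaussianReal 0 1) := by
  rcases n.eq_zero_or_pos with rfl | hn
  · simp
  · have h := (memLp_id_gaussianReal (μ := 0) (v := 1) (n : ℝ≥0)).integrable_norm_pow hn.ne'
    refine h.congr' (by fun_prop) (Eventually.of_forall fun x => by simp)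

/-- Stein's identity for powers; the factor `n` makes the value of `n - 1` at `n = 0` irrelevant. -/
lemma integral_pow_succ_gaussianReal (n : ℕ) :
    ∫ x, x ^ (n + 1) ∂gaussianReal 0 1 = n * ∫ x, x ^ (n - 1) ∂gaussianReal 0 1 := by
  have hint : ∀ k : ℕ, Integrable fun x : ℝ => x ^ k * gaussianPDFReal 0 1 x := by
    intro k
    have := integrable_pow_gaussianReal k
    rw [gaussianReal_of_var_ne_zero _ one_ne_zero,
      integrable_withDensity_iff (measurable_gaussianPDF 0 1)
        (Eventually.of_forall fun _ => gaussianPDF_lt_top)] at this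
    simpa only [toReal_gaussianPDF] using this
  have hd : ∀ x : ℝ, HasDerivAt (gaussianPDFReal 0 1) (-(x * gaussianPDFReal 0 1 x)) x := by
    intro x
    have h1 : HasDerivAt (fun y : ℝ => -(y - 0) ^ 2 / (2 * ((1 : ℝ≥0) : ℝ))) (-x) x := by
      have := (((hasDerivAt_id x).sub_const 0).pow 2).neg.div_const (2 * ((1 : ℝ≥0) : ℝ))
      refine this.congr_deriv ?_
      simp
      ring
    have h2 := h1.exp.const_mul (√(2 * Real.pi * ((1 : ℝ≥0) : ℝ)))⁻¹
    refine h2.congr_deriv ?_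
    rw [gaussianPDFReal]; ring
  have h := integral_eq_zero_of_hasDerivAt_of_integrable
    (f := fun x => x ^ n * gaussianPDFReal 0 1 x)
    (f' := fun x => n * (x ^ (n - 1) * gaussianPDFReal 0 1 x) - x ^ (n + 1) * gaussianPDFReal 0 1 x)
    (fun x => ((hasDerivAt_pow n x).mul (hd x)).congr_deriv (by ring))
    (((hint _).const_mul _).sub (hint _)) (hint n)
  rw [integral_sub ((hint _).const_mul _) (hint _), integral_const_mul] at h
  simp_rw [integral_gaussianReal_eq_integral_smul one_ne_zero, smul_eq_mul,
    mul_comm (gaussianPDFReal 0 1 _)]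
  linarith

section GaussianExpectation

variable {ι : Type*} [Fintype ι]

lemma integrable_eval_gaussian (p : MvPolynomial ι ℂ) :
    Integrable (fun x : ι → ℝ => MvPolynomial.eval (fun i => (x i : ℂ)) p)
      (Measure.pi fun _ => gaussianReal 0 1) := by
  induction p using MvPolynomial.induction_on' with
  | monomial m a =>
    simp_rw [MvPolynomial.eval_monomial]
    refine Integrable.const_mul ?_ a
    simp_rw [Finsupp.prod_pow]
    refine Integrable.fintype_prod (f := fun i (x : ℝ) => (x : ℂ) ^ m i) fun i => ?_
    simpa using (integrable_pow_gaussianReal (m i)).ofReal (𝕜 := ℂ)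
  | add p q hp hq =>
    simp_rw [map_add]
    exact hp.add hq

variable (ι) in
/-- The expectation of a polynomial in independent standard Gaussian variables indexed by `ι`. -/
noncomputable def gaussianExpectation : MvPolynomial ι ℂ →ₗ[ℂ] ℂ where
  toFun p := ∫ x : ι → ℝ, MvPolynomial.eval (fun i => (x i : ℂ)) p
    ∂(Measure.pi fun _ => gaussianReal 0 1)
  map_add' p q := by
    simp_rw [map_add]
    exact integral_add (integrable_eval_gaussian p) (integrable_eval_gaussian q)
  map_smul' a p := by
    simp_rw [MvPolynomial.smul_eval, RingHom.id_apply, smul_eq_mul]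
    exact integral_const_mul _ _

lemma gaussianExpectation_apply (p : MvPolynomial ι ℂ) :
    gaussianExpectation ι p = ∫ x : ι → ℝ, MvPolynomial.eval (fun i => (x i : ℂ)) p
      ∂(Measure.pi fun _ => gaussianReal 0 1) := rfl

lemma gaussianExpectation_one : gaussianExpectation ι 1 = 1 := by
  simp [gaussianExpectation_apply]

lemma gaussianExpectation_monomial (m : ι →₀ ℕ) (a : ℂ) :
    gaussianExpectation ι (MvPolynomial.monomial m a) =
      a * ∏ i, ((∫ x, x ^ m i ∂gaussianReal 0 1 : ℝ) : ℂ) := by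
  simp_rw [gaussianExpectation_apply, MvPolynomial.eval_monomial, Finsupp.prod_pow]
  rw [integral_const_mul, integral_fintype_prod_eq_prod (fun i (x : ℝ) => (x : ℂ) ^ m i)]
  congr 1
  refine Finset.prod_congr rfl fun i _ => ?_
  rw [← integral_complex_ofReal]
  simp

/-- Gaussian integration by parts (Stein's identity). -/
lemma gaussianExpectation_X_mul (i : ι) (p : MvPolynomial ι ℂ) :
    gaussianExpectation ι (MvPolynomial.X i * p) =
      gaussianExpectation ι (MvPolynomial.pderiv i p) := by
  classical
  induction p using MvPolynomial.induction_on' with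
  | monomial m a =>
    rw [MvPolynomial.X, MvPolynomial.monomial_mul, MvPolynomial.pderiv_monomial, one_mul,
      gaussianExpectation_monomial, gaussianExpectation_monomial,
      ← Finset.mul_prod_erase _ _ (Finset.mem_univ i),
      ← Finset.mul_prod_erase (Finset.univ : Finset ι) (fun j =>
        ((∫ x, x ^ (m - Finsupp.single i 1 : ι →₀ ℕ) j ∂gaussianReal 0 1 : ℝ) : ℂ))
        (Finset.mem_univ i)]
    have h : ∀ j ∈ Finset.univ.erase i,
        (Finsupp.single i 1 + m : ι →₀ ℕ) j = (m - Finsupp.single i 1 : ι →₀ ℕ) j := by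
      intro j hj
      simp [Finsupp.single_eq_of_ne (Finset.ne_of_mem_erase hj)]
    rw [Finset.prod_congr rfl fun j hj => by rw [h j hj]]
    have h2 : (Finsupp.single i 1 + m : ι →₀ ℕ) i = m i + 1 := by simp [add_comm]
    have h3 : (m - Finsupp.single i 1 : ι →₀ ℕ) i = m i - 1 := by simp
    rw [h2, h3, integral_pow_succ_gaussianReal]
    push_cast
    ring
  | add p q hp hq => rw [mul_add, map_add, map_add, map_add, hp, hq]

end GaussianExpectation

/-! ### The Gaussian Unitary Ensemble as a polynomial matrix -/

section GUE

variable {N : ℕ}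

/-- The coefficients of the linear form expressing the entry `(i, j)` of `A / √N` through the
coordinates `gueCoord A` of the Hermitian matrix `A`. -/
noncomputable def gueCoeff (i j : Fin N) : GUEIndex N → ℂ :=
  if h : i < j then
    Pi.single (.inr (.inl ⟨(i, j), h⟩)) (1 / (√2 * √N) : ℂ) +
      Pi.single (.inr (.inr ⟨(i, j), h⟩)) (Complex.I / (√2 * √N) : ℂ)
  else if h : j < i then
    Pi.single (.inr (.inl ⟨(j, i), h⟩)) (1 / (√2 * √N) : ℂ) +
      Pi.single (.inr (.inr ⟨(j, i), h⟩)) (-Complex.I / (√2 * √N) : ℂ)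
  else Pi.single (.inl i) (1 / √N : ℂ)

/-- The covariance structure of the ensemble: `E (A i j * A k l) / N = δ_{il} δ_{jk} / N`. -/
lemma gueCoeff_dotProduct_gueCoeff (i j k l : Fin N) :
    gueCoeff i j ⬝ᵥ gueCoeff k l = if i = l ∧ j = k then (N : ℂ)⁻¹ else 0 := by
  have h2 : (√2 : ℂ) * √2 = 2 := by
    exact_mod_cast Real.mul_self_sqrt zero_le_two
  have hN : (√N : ℂ) * √N = N := by
    exact_mod_cast Real.mul_self_sqrt N.cast_nonneg
  have hI := Complex.I_mul_I
  have e1 : (1 / (√2 * √N) : ℂ) * (1 / (√2 * √N)) = (N : ℂ)⁻¹ / 2 := by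
    rw [div_mul_div_comm, mul_mul_mul_comm, h2, hN, one_mul, div_eq_mul_inv, mul_inv]; ring
  have e2 : (1 / √N : ℂ) * (1 / √N) = (N : ℂ)⁻¹ := by
    rw [div_mul_div_comm, hN, one_mul, one_div]
  have e3 : (Complex.I / (√2 * √N) : ℂ) * (Complex.I / (√2 * √N)) = -((N : ℂ)⁻¹ / 2) := by
    rw [← e1]; linear_combination (1 / (√2 * √N) : ℂ) * (1 / (√2 * √N)) * hI
  have hlt : ∀ {a b : Fin N} (h : a < b), gueCoeff a b =
      Pi.single (.inr (.inl ⟨(a, b), h⟩)) (1 / (√2 * √N) : ℂ) +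
        Pi.single (.inr (.inr ⟨(a, b), h⟩)) (Complex.I / (√2 * √N) : ℂ) :=
    fun h => by simp [gueCoeff, h]
  have hgt : ∀ {a b : Fin N} (h : b < a), gueCoeff a b =
      Pi.single (.inr (.inl ⟨(b, a), h⟩)) (1 / (√2 * √N) : ℂ) +
        Pi.single (.inr (.inr ⟨(b, a), h⟩)) (-Complex.I / (√2 * √N) : ℂ) :=
    fun h => by simp [gueCoeff, h, h.not_gt]
  have heq : ∀ a : Fin N, gueCoeff a a = Pi.single (.inl a) (1 / √N : ℂ) :=
    fun a => by simp [gueCoeff]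
  rcases lt_trichotomy i j with hij | hij | hij <;>
    rcases lt_trichotomy k l with hkl | hkl | hkl <;>
    (try subst hij) <;> (try subst hkl) <;>
    (try rw [hlt hij]) <;> (try rw [hgt hij]) <;> (try rw [hlt hkl]) <;> (try rw [hgt hkl]) <;>
    (try simp only [heq]) <;>
    simp only [add_dotProduct, dotProduct_add, single_dotProduct, Pi.single_apply, Sum.inl.injEq,
      Sum.inr.injEq, reduceCtorEq, Subtype.mk.injEq, Prod.mk.injEq, if_false, mul_ite, mul_zero,
      add_zero, neg_div, neg_mul, mul_neg, neg_neg, e1, e2, e3] <;>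
    split_ifs <;> first | ring1 | (exfalso; omega)

/-- The matrix `A / √N`, with `A` in the Gaussian Unitary Ensemble, as a matrix of linear
polynomials in its `N ^ 2` real coordinates. -/
noncomputable def gueMatrix (N : ℕ) : Matrix (Fin N) (Fin N) (MvPolynomial (GUEIndex N) ℂ) :=
  fun i j => ∑ a, gueCoeff i j a • MvPolynomial.X a

/-- The derivation dual to the entry `(i, j)` of `gueMatrix N` under Gaussian integration by
parts. -/
noncomputable def gueDerivation (i j : Fin N) :
    Derivation ℂ (MvPolynomial (GUEIndex N) ℂ) (MvPolynomial (GUEIndex N) ℂ) :=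
  ∑ a, gueCoeff i j a • MvPolynomial.pderiv a

lemma gueDerivation_apply (i j : Fin N) (p : MvPolynomial (GUEIndex N) ℂ) :
    gueDerivation i j p = ∑ a, gueCoeff i j a • MvPolynomial.pderiv a p := by
  simp only [gueDerivation, ← Derivation.coeFnAddMonoidHom_apply, map_sum, Finset.sum_apply]
  simp

lemma gueDerivation_gueMatrix (i j k l : Fin N) :
    gueDerivation i j (gueMatrix N k l) =
      if i = l ∧ j = k then algebraMap ℂ _ (((N : ℝ)⁻¹ : ℝ) : ℂ) else 0 := by
  classical
  have h : gueDerivation i j (gueMatrix N k l) =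
      algebraMap ℂ _ (gueCoeff i j ⬝ᵥ gueCoeff k l) := by
    rw [gueDerivation_apply, dotProduct, map_sum]
    refine Finset.sum_congr rfl fun a _ => ?_
    rw [gueMatrix, map_sum, Finset.sum_eq_single a]
    · rw [Derivation.map_smul, MvPolynomial.pderiv_X_self, smul_smul,
        Algebra.algebraMap_eq_smul_one]
    · intro b _ hb
      rw [Derivation.map_smul, MvPolynomial.pderiv_X_of_ne hb, smul_zero]
    · simp
  rw [h, gueCoeff_dotProduct_gueCoeff]
  split_ifs <;> simp

lemma gaussianExpectation_gueMatrix_mul (i j : Fin N) (p : MvPolynomial (GUEIndex N) ℂ) :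
    gaussianExpectation _ (gueMatrix N i j * p) = gaussianExpectation _ (gueDerivation i j p) := by
  simp_rw [gueMatrix, gueDerivation_apply, Finset.sum_mul, map_sum, smul_mul_assoc, map_smul,
    gaussianExpectation_X_mul]

lemma loopEquations_gue [NeZero N] :
    LoopEquations (fun l => gaussianExpectation _ (traceProd (N : ℝ)⁻¹ (gueMatrix N) l))
      (N : ℝ)⁻¹ :=
  loopEquations_traceProd gueDerivation_gueMatrix gaussianExpectation_gueMatrix_mul
    gaussianExpectation_one (by positivity)
    (inv_le_one_of_one_le₀ (by exact_mod_cast NeZero.one_le))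
    (by rw [Fintype.card_fin, inv_mul_cancel₀ (NeZero.ne _)])

lemma eval_gueMatrix (A : HermitianMatrix N) (i j : Fin N) :
    MvPolynomial.eval (fun a => (gueCoord A a : ℂ)) (gueMatrix N i j) = (√N : ℂ)⁻¹ * A.1 i j := by
  have h0 : (√2 : ℂ) ≠ 0 := by simp
  have h : MvPolynomial.eval (fun a => (gueCoord A a : ℂ)) (gueMatrix N i j) =
      gueCoeff i j ⬝ᵥ fun a => (gueCoord A a : ℂ) := by
    simp [gueMatrix, dotProduct, MvPolynomial.smul_eval]
  have hH : A.1 i j = star (A.1 j i) := (A.2.apply i j).symm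
  rw [h]
  rcases lt_trichotomy i j with hij | rfl | hij
  · simp only [gueCoeff, hij, dif_pos, add_dotProduct, single_dotProduct, gueCoord]
    conv_rhs => rw [← Complex.re_add_im (A.1 i j)]
    push_cast
    field_simp
  · have him : ((A.1 i i).re : ℂ) = A.1 i i := Complex.conj_eq_iff_re.1 hH.symm
    simp [gueCoeff, gueCoord, him]
  · simp only [gueCoeff, hij, hij.not_gt, dif_pos, dif_neg, not_false_eq_true, add_dotProduct,
      single_dotProduct, gueCoord]
    rw [hH]
    conv_rhs => rw [← Complex.re_add_im (A.1 j i)]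
    simp
    field_simp
    apply Complex.ext <;> simp

lemma trace_pow_eq_sum_eigenvalues (A : HermitianMatrix N) (k : ℕ) :
    (A.1 ^ k).trace = ∑ i, (A.2.eigenvalues i : ℂ) ^ k := by
  conv_lhs => rw [A.2.spectral_theorem, ← map_pow, Unitary.conjStarAlgAut_apply,
    Matrix.trace_mul_cycle, Unitary.coe_star_mul_self, one_mul, Matrix.diagonal_pow,
    Matrix.trace_diagonal]
  simp

/-- The `k`-th moment of the empirical spectral distribution of `A / √N`. -/
noncomputable def spectralMoment (A : HermitianMatrix N) (k : ℕ) : ℝ :=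
  ∫ x, x ^ k ∂scaledSpectralMeasure A

lemma integral_scaledSpectralMeasure (A : HermitianMatrix N) (f : ℝ → ℝ) :
    ∫ x, f x ∂scaledSpectralMeasure A =
      (N : ℝ)⁻¹ * ∑ k : Fin N, f (A.2.eigenvalues k / √(N : ℝ)) := by
  rw [scaledSpectralMeasure, integral_smul_measure, integral_finsetSum_measure]
  · simp
  · exact fun i _ => integrable_dirac (by simp)

/-- At the coordinates of `A`, the normalized traces of powers of `gueMatrix N` become the moments
of the empirical spectral distribution. -/
lemma eval_traceProd_gueMatrix (A : HermitianMatrix N) (l : List ℕ) :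
    MvPolynomial.eval (fun a => (gueCoord A a : ℂ)) (traceProd (N : ℝ)⁻¹ (gueMatrix N) l) =
      (l.map fun k => (spectralMoment A k : ℂ)).prod := by
  rw [traceProd, map_list_prod, List.map_map]
  congr 2
  funext k
  set f := MvPolynomial.eval (fun a => (gueCoord A a : ℂ)) with hf
  have h1 : f.mapMatrix (gueMatrix N) = (√N : ℂ)⁻¹ • A.1 := by
    ext i j
    simp [hf, eval_gueMatrix]
  have h2 : f (gueMatrix N ^ k).trace = (f.mapMatrix (gueMatrix N) ^ k).trace := by
    rw [← map_pow]
    simp [Matrix.trace]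
  rw [Function.comp_apply, MvPolynomial.smul_eval, ← hf, h2, h1, smul_pow, Matrix.trace_smul,
    trace_pow_eq_sum_eigenvalues, spectralMoment, integral_scaledSpectralMeasure]
  push_cast
  simp_rw [smul_eq_mul, Finset.mul_sum, div_pow, div_eq_inv_mul, inv_pow]

variable {Ω : Type*} [MeasurableSpace Ω] {P : Measure Ω} {X : Ω → HermitianMatrix N}

lemma IsGUE.map_eq (hX : IsGUE X P) :
    P.map (fun ω a => gueCoord (X ω) a) = Measure.pi fun _ => gaussianReal 0 1 := by
  have := hX.indep.isProbabilityMeasure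
  rw [(iIndepFun_iff_map_fun_eq_pi_map fun a => (hX.hasLaw a).aemeasurable).1 hX.indep]
  simp_rw [(hX.hasLaw _).map_eq]

lemma IsGUE.aemeasurable_gueCoord (hX : IsGUE X P) :
    AEMeasurable (fun ω a => gueCoord (X ω) a) P :=
  aemeasurable_pi_lambda _ fun a => (hX.hasLaw a).aemeasurable

lemma IsGUE.integrable_eval (hX : IsGUE X P) (p : MvPolynomial (GUEIndex N) ℂ) :
    Integrable (fun ω => MvPolynomial.eval (fun a => (gueCoord (X ω) a : ℂ)) p) P := by
  have h := integrable_eval_gaussian p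
  rw [← hX.map_eq] at h
  exact h.comp_aemeasurable hX.aemeasurable_gueCoord

lemma IsGUE.integral_eval (hX : IsGUE X P) (p : MvPolynomial (GUEIndex N) ℂ) :
    ∫ ω, MvPolynomial.eval (fun a => (gueCoord (X ω) a : ℂ)) p ∂P = gaussianExpectation _ p := by
  have h := (integrable_eval_gaussian p).aestronglyMeasurable
  rw [← hX.map_eq] at h
  rw [gaussianExpectation_apply, ← hX.map_eq, integral_map hX.aemeasurable_gueCoord h]

lemma IsGUE.integrable_sq_spectralMoment_sub (hX : IsGUE X P) (k : ℕ) (m : ℝ) :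
    Integrable (fun ω => (spectralMoment (X ω) k - m) ^ 2) P := by
  have h := (hX.integrable_eval
    ((traceProd (N : ℝ)⁻¹ (gueMatrix N) [k] - MvPolynomial.C (m : ℂ)) ^ 2)).re
  refine h.congr (Eventually.of_forall fun ω => ?_)
  simp only [map_pow, map_sub, eval_traceProd_gueMatrix, MvPolynomial.eval_C, List.map_cons,
    List.map_nil, List.prod_cons, List.prod_nil, mul_one]
  exact_mod_cast RCLike.ofReal_re (K := ℂ) _

/-- The spectral moments of the ensemble concentrate: their mean square distance to the solution of
the limiting recursion is of order `N ^ (-2)`. -/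
theorem exists_integral_sq_spectralMoment_sub_le {m : ℕ → ℝ} (m_zero : m 0 = 1)
    (m_succ : ∀ k, m (k + 1) = ∑ a ∈ Finset.range k, m a * m (k - 1 - a)) (k : ℕ) :
    ∃ C : ℝ, ∀ {N : ℕ} [NeZero N] {Ω : Type*} [MeasurableSpace Ω] {P : Measure Ω}
      {X : Ω → HermitianMatrix N}, IsGUE X P →
      ∫ ω, (spectralMoment (X ω) k - m k) ^ 2 ∂P ≤ C * ((N : ℝ)⁻¹) ^ 2 := by
  have hm := LoopEquations.exists_norm_sub_le (m := fun k => (m k : ℂ)) (by simp [m_zero])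
    fun k => by rw [m_succ]; push_cast; rfl
  obtain ⟨C₁, h₁⟩ := hm [k]
  obtain ⟨C₂, h₂⟩ := hm [k, k]
  refine ⟨C₂ + 2 * |m k| * C₁, fun {N} _ {Ω} _ {P} {X} hX => ?_⟩
  have e₁ := h₁ _ _ (loopEquations_gue (N := N))
  have e₂ := h₂ _ _ (loopEquations_gue (N := N))
  set T := traceProd (N : ℝ)⁻¹ (gueMatrix N) with hT
  have hTT : T [k, k] = T [k] * T [k] := by simp [hT, traceProd]
  -- Expand the square: `E (t - m)² = (E t² - m²) - 2 m (E t - m)`.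
  have h : ((∫ ω, (spectralMoment (X ω) k - m k) ^ 2 ∂P : ℝ) : ℂ) =
      (gaussianExpectation _ (T [k, k]) - m k * m k) -
        2 * m k * (gaussianExpectation _ (T [k]) - m k) := by
    have e : (T [k] - MvPolynomial.C (m k : ℂ)) ^ 2 =
        T [k, k] - (2 * m k : ℂ) • T [k] + (m k ^ 2 : ℂ) • 1 := by
      rw [hTT]
      simp only [MvPolynomial.smul_eq_C_mul, map_mul, map_pow, map_ofNat]
      ring
    have h := hX.integral_eval ((T [k] - MvPolynomial.C (m k : ℂ)) ^ 2)
    rw [e, map_add, map_sub, map_smul, map_smul, gaussianExpectation_one, ← e] at h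
    rw [← integral_complex_ofReal]
    calc _ = _ := integral_congr_ae (Eventually.of_forall fun ω => by
            simp [hT, eval_traceProd_gueMatrix])
      _ = _ := h
      _ = _ := by simp only [smul_eq_mul]; ring
  refine (le_abs_self _).trans ?_
  rw [← Real.norm_eq_abs, ← Complex.norm_real, h]
  refine (norm_sub_le _ _).trans ?_
  rw [norm_mul, norm_mul, Complex.norm_real, Real.norm_eq_abs, Complex.norm_ofNat, add_mul,
    mul_assoc (2 * |m k|)]
  refine add_le_add (by simpa using e₂) (mul_le_mul_of_nonneg_left (by simpa using e₁) ?_)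
  positivity

end GUE

/-! ### Moments of the semicircle distribution -/

/-- The moments of the semicircle distribution: the Catalan number `catalan j` in degree `2 * j`,
and `0` in odd degree. -/
def semicircleMoment (k : ℕ) : ℝ :=
  if Even k then catalan (k / 2) else 0

lemma semicircleMoment_two_mul (j : ℕ) : semicircleMoment (2 * j) = catalan j := by
  simp [semicircleMoment]

lemma semicircleMoment_of_odd {k : ℕ} (hk : Odd k) : semicircleMoment k = 0 := by
  simp [semicircleMoment, Nat.not_even_iff_odd.2 hk]

lemma semicircleMoment_zero : semicircleMoment 0 = 1 := by
  simp [semicircleMoment]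

lemma sum_range_two_mul_add_one_of_odd_eq_zero {f : ℕ → ℝ} (hf : ∀ k, Odd k → f k = 0) (n : ℕ) :
    ∑ a ∈ Finset.range (2 * n + 1), f a = ∑ i ∈ Finset.range (n + 1), f (2 * i) := by
  induction n with
  | zero => simp
  | succ n ih =>
    rw [Finset.sum_range_succ _ (n + 1), ← ih, show 2 * (n + 1) + 1 = 2 * n + 1 + 1 + 1 by ring,
      Finset.sum_range_succ, Finset.sum_range_succ, hf (2 * n + 1) (odd_two_mul_add_one n)]
    simp [mul_add]

/-- The `c = 0` case of the loop equations, which is Segner's recursion for the Catalan numbers. -/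
lemma semicircleMoment_succ (k : ℕ) : semicircleMoment (k + 1) =
    ∑ a ∈ Finset.range k, semicircleMoment a * semicircleMoment (k - 1 - a) := by
  rcases k.even_or_odd with hk | ⟨j, rfl⟩
  · rw [semicircleMoment_of_odd hk.add_one, Finset.sum_eq_zero]
    intro a ha
    rw [Finset.mem_range] at ha
    rcases a.even_or_odd with h | h
    · have : Odd (k - 1 - a) := by
        rw [Nat.sub_sub, Nat.add_comm, Nat.odd_sub' (by omega)]
        exact ⟨fun _ => hk, fun _ => h.add_one⟩
      rw [semicircleMoment_of_odd this, mul_zero]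
    · rw [semicircleMoment_of_odd h, zero_mul]
  · rw [sum_range_two_mul_add_one_of_odd_eq_zero fun a ha => by
        rw [semicircleMoment_of_odd ha, zero_mul],
      show 2 * j + 1 + 1 = 2 * (j + 1) by ring, semicircleMoment_two_mul, catalan_succ,
      Fin.sum_univ_eq_sum_range (fun i => catalan i * catalan (j - i))]
    push_cast
    refine Finset.sum_congr rfl fun i _ => ?_
    rw [← Nat.mul_sub, semicircleMoment_two_mul,
      semicircleMoment_two_mul]

lemma semicircleMoment_add_two (n : ℕ) :
    (n + 4 : ℝ) * semicircleMoment (n + 2) = 4 * (n + 1) * semicircleMoment n := by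
  rcases n.even_or_odd' with ⟨j, rfl | rfl⟩
  · rw [show 2 * j + 2 = 2 * (j + 1) by ring, semicircleMoment_two_mul, semicircleMoment_two_mul]
    have h1 := succ_mul_catalan_eq_centralBinom j
    have h2 := succ_mul_catalan_eq_centralBinom (j + 1)
    have h3 := Nat.succ_mul_centralBinom_succ j
    rw [← h1, ← h2] at h3
    have h4 : (j + 1 : ℝ) * ((j + 1 + 1) * catalan (j + 1)) =
        2 * (2 * j + 1) * ((j + 1) * catalan j) := by exact_mod_cast h3
    have h5 : (j + 1 : ℝ) ≠ 0 := by positivity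
    apply mul_left_cancel₀ h5
    push_cast
    linear_combination 2 * h4
  · rw [semicircleMoment_of_odd (odd_two_mul_add_one j),
      semicircleMoment_of_odd ((odd_two_mul_add_one j).add_even even_two), mul_zero, mul_zero]

lemma integral_semicircleMeasure (f : ℝ → ℝ) :
    ∫ x, f x ∂semicircleMeasure = ∫ x in (-2 : ℝ)..2, f x * (√(4 - x ^ 2) / (2 * Real.pi)) := by
  have hc : Continuous fun y : ℝ => √(4 - y ^ 2) / (2 * Real.pi) := by fun_prop
  have hm : Measurable semicircleDensity := hc.measurable.indicator measurableSet_Icc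
  have h0 : ∀ x, 0 ≤ semicircleDensity x :=
    fun x => Set.indicator_nonneg (fun y _ => by positivity) x
  rw [semicircleMeasure, integral_withDensity_eq_integral_toReal_smul hm.ennreal_ofReal
    (Eventually.of_forall fun _ => ENNReal.ofReal_lt_top),
    intervalIntegral.integral_of_le (by norm_num), ← integral_Icc_eq_integral_Ioc,
    ← integral_indicator measurableSet_Icc]
  congr 1
  ext x
  rw [ENNReal.toReal_ofReal (h0 x), smul_eq_mul, semicircleDensity, mul_comm]
  by_cases hx : x ∈ Set.Icc (-2 : ℝ) 2 <;> simp [hx]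

/-- Integrate the derivative of `x ^ (n + 1) * (4 - x ^ 2) ^ (3 / 2)` over `[-2, 2]`. -/
lemma integral_pow_add_two_semicircleMeasure (n : ℕ) :
    (n + 4 : ℝ) * ∫ x, x ^ (n + 2) ∂semicircleMeasure =
      4 * (n + 1) * ∫ x, x ^ n ∂semicircleMeasure := by
  have hd : ∀ x ∈ Set.Ioo (-2 : ℝ) 2, HasDerivAt
      (fun x : ℝ => x ^ (n + 1) * ((4 - x ^ 2) * √(4 - x ^ 2)))
      (4 * (n + 1) * (x ^ n * √(4 - x ^ 2)) - (n + 4) * (x ^ (n + 2) * √(4 - x ^ 2))) x := by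
    intro x hx
    have hpos : 0 < 4 - x ^ 2 := by nlinarith [hx.1, hx.2]
    have h1 : HasDerivAt (fun x : ℝ => 4 - x ^ 2) (-(2 * x)) x := by
      simpa using (hasDerivAt_pow 2 x).const_sub 4
    have h2 := h1.mul (h1.sqrt hpos.ne')
    refine ((hasDerivAt_pow (n + 1) x).mul h2).congr_deriv ?_
    have hs : √(4 - x ^ 2) ≠ 0 := (Real.sqrt_pos.2 hpos).ne'
    have hsq : √(4 - x ^ 2) ^ 2 = 4 - x ^ 2 := Real.sq_sqrt hpos.le
    have h3 : (4 - x ^ 2) * (-(2 * x) / (2 * √(4 - x ^ 2))) = -x * √(4 - x ^ 2) := by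
      field_simp
      rw [hsq]
    rw [h3]
    push_cast
    simp only [Pi.mul_apply]
    ring
  have hint : ∀ k, IntervalIntegrable (fun x : ℝ => x ^ k * √(4 - x ^ 2)) volume (-2) 2 :=
    fun k => (by fun_prop : Continuous fun x : ℝ => x ^ k * √(4 - x ^ 2)).intervalIntegrable _ _
  have h := intervalIntegral.integral_eq_sub_of_hasDerivAt_of_le (by norm_num)
    (by fun_prop : Continuous fun x : ℝ =>
      x ^ (n + 1) * ((4 - x ^ 2) * √(4 - x ^ 2))).continuousOn hd
    (((hint n).const_mul _).sub ((hint (n + 2)).const_mul _))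
  rw [intervalIntegral.integral_sub ((hint n).const_mul _) ((hint (n + 2)).const_mul _),
    intervalIntegral.integral_const_mul, intervalIntegral.integral_const_mul] at h
  norm_num at h
  simp_rw [integral_semicircleMeasure, mul_div_assoc', intervalIntegral.integral_div]
  linear_combination (-(2 * Real.pi)⁻¹) * h

theorem integral_pow_semicircleMeasure (k : ℕ) :
    ∫ x, x ^ k ∂semicircleMeasure = semicircleMoment k := by
  induction k using Nat.twoStepInduction with
  | zero => simp [semicircleMoment_zero]
  | one =>
    rw [semicircleMoment_of_odd odd_one, integral_semicircleMeasure]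
    have h := intervalIntegral.integral_comp_neg (a := -2) (b := 2)
      fun x : ℝ => x ^ 1 * (√(4 - x ^ 2) / (2 * Real.pi))
    simp only [pow_one, neg_sq, neg_mul, intervalIntegral.integral_neg, neg_neg] at h ⊢
    linarith
  | more n h _ =>
    have h1 := integral_pow_add_two_semicircleMeasure n
    rw [h, ← semicircleMoment_add_two] at h1
    exact mul_left_cancel₀ (by positivity) h1

lemma ae_semicircleMeasure_abs_le : ∀ᵐ x ∂semicircleMeasure, |x| ≤ 2 := by
  have hc : Continuous fun y : ℝ => √(4 - y ^ 2) / (2 * Real.pi) := by fun_prop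
  have hm : Measurable semicircleDensity := hc.measurable.indicator measurableSet_Icc
  rw [semicircleMeasure, ae_withDensity_iff hm.ennreal_ofReal]
  refine Eventually.of_forall fun x hx => ?_
  contrapose! hx
  have : x ∉ Set.Icc (-2 : ℝ) 2 := fun h => hx.not_ge (abs_le.2 h)
  simp [semicircleDensity, this]

/-! ### Convergence of moments implies weak convergence -/

lemma Polynomial.abs_eval_le_of_one_le_abs (p : Polynomial ℝ) {x : ℝ} (hx : 1 ≤ |x|) :
    |p.eval x| ≤ (∑ i ∈ Finset.range (p.natDegree + 1), |p.coeff i|) * x ^ (2 * p.natDegree) := by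
  rw [Polynomial.eval_eq_sum_range, Finset.sum_mul]
  refine (Finset.abs_sum_le_sum_abs _ _).trans (Finset.sum_le_sum fun i hi => ?_)
  rw [abs_mul, abs_pow, ← (even_two_mul p.natDegree).pow_abs x]
  rw [Finset.mem_range] at hi
  have hi' : i ≤ 2 * p.natDegree := by omega
  gcongr

lemma Polynomial.integrable_eval {μ : Measure ℝ} (hμ : ∀ k : ℕ, Integrable (fun x => x ^ k) μ)
    (p : Polynomial ℝ) : Integrable (fun x => p.eval x) μ := by
  simp_rw [Polynomial.eval_eq_sum_range]
  exact integrable_finsetSum _ fun i _ => (hμ i).const_mul _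

lemma Polynomial.integral_eval {μ : Measure ℝ} (hμ : ∀ k : ℕ, Integrable (fun x => x ^ k) μ)
    (p : Polynomial ℝ) :
    ∫ x, p.eval x ∂μ = ∑ i ∈ Finset.range (p.natDegree + 1), p.coeff i * ∫ x, x ^ i ∂μ := by
  simp_rw [Polynomial.eval_eq_sum_range]
  rw [integral_finsetSum _ fun i _ => (hμ i).const_mul _]
  simp_rw [integral_const_mul]

/-- A polynomial approximation of `f` on `[-R, R]` also controls the integral of `f`, up to a
multiple of a high moment divided by the corresponding power of `R`. -/
lemma exists_polynomial_abs_integral_sub_le (f : BoundedContinuousFunction ℝ ℝ) {R : ℝ}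
    (hR : 1 ≤ R) {ε : ℝ} (hε : 0 < ε) :
    ∃ (p : Polynomial ℝ) (K : ℝ) (d : ℕ), 0 ≤ K ∧ ∀ (μ : Measure ℝ) [IsProbabilityMeasure μ],
      (∀ k : ℕ, Integrable (fun x => x ^ k) μ) → ∀ n : ℕ,
      |∫ x, f x ∂μ - ∫ x, p.eval x ∂μ| ≤ ε + K * (∫ x, x ^ (2 * d + 2 * n) ∂μ) / R ^ (2 * n) := by
  obtain ⟨p, hp⟩ := exists_polynomial_near_of_continuousOn (-R) R f f.continuous.continuousOn ε hε
  set S := ∑ i ∈ Finset.range (p.natDegree + 1), |p.coeff i| with hS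
  have hS0 : 0 ≤ S := Finset.sum_nonneg fun i _ => abs_nonneg _
  refine ⟨p, ‖f‖ + S, p.natDegree, by positivity, fun μ _ hμ n => ?_⟩
  -- On `[-R, R]` the first term dominates; outside, `|p x|` and `‖f‖` are at most multiples of
  -- `x ^ (2 * p.natDegree)`, and `(x / R) ^ (2 * n) ≥ 1`.
  have hpt : ∀ x, |f x - p.eval x| ≤
      ε + (‖f‖ + S) * x ^ (2 * p.natDegree + 2 * n) / R ^ (2 * n) := by
    intro x
    have hx0 : 0 ≤ x ^ (2 * p.natDegree + 2 * n) := by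
      rw [← mul_add]; exact (even_two_mul _).pow_nonneg x
    by_cases hx : |x| ≤ R
    · have h1 := hp x (abs_le.1 hx)
      rw [abs_sub_comm] at h1
      have : 0 ≤ (‖f‖ + S) * x ^ (2 * p.natDegree + 2 * n) / R ^ (2 * n) := by positivity
      linarith
    · rw [not_le] at hx
      have hx1 : 1 ≤ |x| := hR.trans hx.le
      have h1 : |f x - p.eval x| ≤ ‖f‖ + S * x ^ (2 * p.natDegree) :=
        (abs_sub _ _).trans (add_le_add (f.norm_coe_le_norm x) (p.abs_eval_le_of_one_le_abs hx1))
      have h2 : 1 ≤ x ^ (2 * p.natDegree) := by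
        rw [← (even_two_mul p.natDegree).pow_abs x]; exact one_le_pow₀ hx1
      have h3 : R ^ (2 * n) ≤ x ^ (2 * n) := by
        rw [← (even_two_mul n).pow_abs x]; gcongr
      have h4 : ‖f‖ ≤ ‖f‖ * x ^ (2 * p.natDegree) := le_mul_of_one_le_right (norm_nonneg _) h2
      have h5 : (‖f‖ + S) * x ^ (2 * p.natDegree) ≤
          (‖f‖ + S) * x ^ (2 * p.natDegree + 2 * n) / R ^ (2 * n) := by
        rw [le_div_iff₀ (by positivity), pow_add, ← mul_assoc]
        gcongr
      linarith
  have hf := f.integrable μ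
  rw [← integral_sub hf (p.integrable_eval hμ)]
  refine (abs_integral_le_integral_abs).trans ?_
  refine (integral_mono (hf.sub (p.integrable_eval hμ)).abs
    ((integrable_const ε).add (((hμ _).const_mul _).div_const _)) hpt).trans ?_
  simp only [Pi.add_apply]
  rw [integral_add (integrable_const ε) (((hμ _).const_mul _).div_const _), integral_div,
    integral_const_mul]
  simp

/-- Convergence of all moments to those of a compactly supported measure implies weak convergence:
by Weierstrass, a bounded continuous function is close to a polynomial on `[-(r + 1), r + 1]`, and
high moments show that little mass escapes from there. -/
theorem tendsto_probabilityMeasure_of_tendsto_moments {ι : Type*} {F : Filter ι}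
    {μ : ι → ProbabilityMeasure ℝ} {ν : ProbabilityMeasure ℝ}
    (hμ : ∀ i (k : ℕ), Integrable (fun x => x ^ k) (μ i : Measure ℝ)) {r : ℝ} (hr : 0 ≤ r)
    (hν : ∀ᵐ x ∂(ν : Measure ℝ), |x| ≤ r)
    (h : ∀ k : ℕ, Tendsto (fun i => ∫ x, x ^ k ∂(μ i : Measure ℝ)) F
      (𝓝 (∫ x, x ^ k ∂(ν : Measure ℝ)))) :
    Tendsto μ F (𝓝 ν) := by
  have hν' : ∀ k : ℕ, Integrable (fun x => x ^ k) (ν : Measure ℝ) := fun k =>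
    Integrable.of_bound (by fun_prop) (r ^ k) (hν.mono fun x hx => by
      rw [norm_pow, Real.norm_eq_abs]; gcongr)
  have hνr : ∀ k : ℕ, ∫ x, x ^ k ∂(ν : Measure ℝ) ≤ r ^ k := fun k => by
    have := integral_mono_ae (hν' k) (integrable_const (r ^ k)) (hν.mono fun x hx =>
      (le_abs_self _).trans (by rw [abs_pow]; gcongr : |x ^ k| ≤ r ^ k))
    simpa using this
  rw [ProbabilityMeasure.tendsto_iff_forall_integral_tendsto]
  intro f
  rw [Metric.tendsto_nhds]
  intro ε hε
  obtain ⟨p, K, d, hK, hp⟩ := exists_polynomial_abs_integral_sub_le f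
    (by linarith : 1 ≤ r + 1) (by positivity : 0 < ε / 5)
  obtain ⟨n, hn⟩ : ∃ n : ℕ, K * r ^ (2 * d + 2 * n) / (r + 1) ^ (2 * n) < ε / 5 := by
    have h0 : 0 ≤ (r / (r + 1)) ^ 2 := by positivity
    have h1 : (r / (r + 1)) ^ 2 < 1 := by
      rw [sq_lt_one_iff₀ (by positivity), div_lt_one (by positivity)]; linarith
    have ht := (tendsto_pow_atTop_nhds_zero_of_lt_one h0 h1).const_mul (K * r ^ (2 * d))
    rw [mul_zero] at ht
    obtain ⟨n, hn⟩ := (ht.eventually_lt_const (by positivity : 0 < ε / 5)).exists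
    refine ⟨n, lt_of_eq_of_lt ?_ hn⟩
    rw [← pow_mul, div_pow, pow_add]
    ring
  -- The tail term for `μ i` tends to the one for `ν`, which is small by the choice of `n`.
  have htail : ∀ᶠ i in F,
      K * (∫ x, x ^ (2 * d + 2 * n) ∂(μ i : Measure ℝ)) / (r + 1) ^ (2 * n) < ε / 5 := by
    refine (((h (2 * d + 2 * n)).const_mul K).div_const _).eventually_lt_const
      (lt_of_le_of_lt ?_ hn)
    gcongr
    exact hνr _
  have hpoly : Tendsto (fun i => ∫ x, p.eval x ∂(μ i : Measure ℝ)) F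
      (𝓝 (∫ x, p.eval x ∂(ν : Measure ℝ))) := by
    rw [Polynomial.integral_eval hν']
    simp_rw [Polynomial.integral_eval (hμ _)]
    exact tendsto_finsetSum _ fun k _ => (h k).const_mul _
  filter_upwards [htail, Metric.tendsto_nhds.1 hpoly (ε / 5) (by positivity)] with i hi hi'
  have hνtail : K * (∫ x, x ^ (2 * d + 2 * n) ∂(ν : Measure ℝ)) / (r + 1) ^ (2 * n) < ε / 5 := by
    refine lt_of_le_of_lt ?_ hn
    gcongr
    exact hνr _
  have e1 := abs_le.1 (hp (μ i) (hμ i) n)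
  have e2 := abs_le.1 (hp ν hν' n)
  rw [Real.dist_eq, abs_lt] at hi' ⊢
  constructor <;> linarith [e1.1, e1.2, e2.1, e2.2, hi'.1, hi'.2]

/-! ### Almost sure convergence -/

/-- Almost sure convergence to `0` from summability of the expectations. -/
lemma ae_tendsto_zero_of_summable_integral {Ω ι : Type*} [MeasurableSpace Ω] [Countable ι]
    {P : Measure Ω} {f : ι → Ω → ℝ} (hf : ∀ i, Integrable (f i) P) (hf0 : ∀ i ω, 0 ≤ f i ω)
    (hs : Summable fun i => ∫ ω, f i ω ∂P) :
    ∀ᵐ ω ∂P, Tendsto (fun i => f i ω) cofinite (𝓝 0) := by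
  -- By Tonelli the series `∑ i, f i ω` has finite expectation, so it converges almost surely.
  have h : ∫⁻ ω, ∑' i, ENNReal.ofReal (f i ω) ∂P ≠ ∞ := by
    rw [lintegral_tsum fun i => (hf i).aemeasurable.ennreal_ofReal]
    simp_rw [← ofReal_integral_eq_lintegral_ofReal (hf _) (Eventually.of_forall (hf0 _))]
    exact hs.tsum_ofReal_ne_top
  filter_upwards [ae_lt_top' (AEMeasurable.tsum fun i => (hf i).aemeasurable.ennreal_ofReal) h]
    with ω hω
  have := ENNReal.summable_toReal hω.ne
  simp_rw [ENNReal.toReal_ofReal (hf0 _ _)] at this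
  exact this.tendsto_cofinite_zero

theorem mainTheorem3 {Ω : Type*} [MeasurableSpace Ω] (P : Measure Ω) [IsProbabilityMeasure P]
    (M : (N : ℕ+) → Ω → HermitianMatrix (N : ℕ))
    (hM : ∀ N : ℕ+, IsGUE (M N) P) :
    ∀ᵐ ω ∂P, Tendsto (fun N : ℕ+ => empiricalSpectralDistribution (M N ω)) atTop
      (𝓝 semicircleDistribution) := by
  have key : ∀ k : ℕ, ∀ᵐ ω ∂P,
      Tendsto (fun N : ℕ+ => spectralMoment (M N ω) k) atTop (𝓝 (semicircleMoment k)) := by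
    intro k
    obtain ⟨C, hC⟩ := exists_integral_sq_spectralMoment_sub_le semicircleMoment_zero
      semicircleMoment_succ k
    have hs : Summable fun N : ℕ+ => C * (((N : ℕ) : ℝ)⁻¹) ^ 2 := by
      have := (Real.summable_nat_pow_inv (p := 2)).2 one_lt_two
      simp_rw [inv_pow]
      exact (this.comp_injective PNat.coe_injective).mul_left C
    filter_upwards [ae_tendsto_zero_of_summable_integral
      (fun N : ℕ+ => (hM N).integrable_sq_spectralMoment_sub k (semicircleMoment k))
      (fun _ _ => sq_nonneg _)
      (hs.of_nonneg_of_le (fun N => integral_nonneg fun _ => sq_nonneg _) fun N => hC (hM N))]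
      with ω hω
    have h := (hω.mono_left atTop_le_cofinite).sqrt
    simp_rw [Real.sqrt_sq_eq_abs, Real.sqrt_zero] at h
    exact tendsto_sub_nhds_zero_iff.1 ((tendsto_zero_iff_abs_tendsto_zero _).2 h)
  filter_upwards [ae_all_iff.2 key] with ω hω
  refine tendsto_probabilityMeasure_of_tendsto_moments (r := 2) ?_ zero_le_two
    ae_semicircleMeasure_abs_le fun k => ?_
  · intro N k
    have : Integrable (fun x : ℝ => x ^ k) (∑ j : Fin N,
        Measure.dirac ((M N ω).2.eigenvalues j / √((N : ℕ) : ℝ))) :=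
      integrable_finsetSum_measure.2 fun j _ => integrable_dirac (by simp)
    exact this.smul_measure (by simp)
  · have h := hω k
    rw [← integral_pow_semicircleMeasure] at h
    exact h
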